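/- Let $X$ be a metrizable topological space. Let $CL(X)$ be the set of all nonempty closed subsets of $X$, and let $\tau_F$ be the Fell topology on $CL(X)$, that is, the topology generated by the subbase consisting of all sets $U^-=\{A\in CL(X): A\cap U\neq\emptyset\}$ with $U\subseteq X$ nonempty and open, and all sets $(X\setminus K)^+=\{A\in CL(X): A\subseteq X\setminus K\}$ with $K\subsetneq X$ compact. Then the following statements are equivalent: 1. $(CL(X),\tau_F)$ is a Fréchet–Urysohn space with an $\omega^\omega$-base; 2. $(CL(X),\tau_F)$ is first-countable; 3. $X$ is locally compact and second countable. Here a space $Y$ is Fréchet–Urysohn if, for every $A\subseteq Y$, each point of $\overline{A}$ is the limit of a sequence of points of $A$. A space $Y$ has an $\omega^\omega$-base if each $y\in Y$ has a neighborhood base $\{U_\alpha[y]:\alpha\in\omega^\omega\}$ such that $U_\beta[y]\subseteq U_\alpha[y]$ whenever $\alpha\le\beta$, where $\omega^\omega$ is the set of all functions $\omega\to\omega$ ordered by $\alpha\le\beta$ iff $\alpha(n)\le\beta(n)$ for all $n$. -/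

import Mathlib

open Topology

universe u

/-- The hyperspace `CL(X)`: all nonempty closed subsets of `X`. -/
def CL (X : Type u) [TopologicalSpace X] : Type u :=
  {A : Set X // A.Nonempty ∧ IsClosed A}

namespace CL

variable {X : Type u} [TopologicalSpace X]

/-- `U⁻`: the nonempty closed sets that meet `U`. -/
def hit (U : Set X) : Set (CL X) := {A | (A.1 ∩ U).Nonempty}

/-- `U⁺`: the nonempty closed sets that are contained in `U`. -/
def inside (U : Set X) : Set (CL X) := {A | A.1 ⊆ U}

/-- The Fell topology `τ_F` on `CL(X)`, generated by the subbase of all `U⁻` with `U` nonempty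
and open in `X` and all `(Kᶜ)⁺` with `K` compact and `K ≠ X`. It is the topology that `CL X`
carries as an instance. -/
instance fellTopology : TopologicalSpace (CL X) :=
  TopologicalSpace.generateFrom
    ({S | ∃ U : Set X, IsOpen U ∧ U.Nonempty ∧ S = hit U} ∪
      {S | ∃ K : Set X, IsCompact K ∧ K ≠ Set.univ ∧ S = inside Kᶜ})

end CL

/-- `Y` has an `ω^ω`-base: each point `y` has a neighborhood base `{U α : α ∈ ω^ω}` with
`U β ⊆ U α` whenever `α ≤ β` pointwise. -/
def HasOmegaOmegaBase (Y : Type u) [TopologicalSpace Y] : Prop :=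
  ∀ y : Y, ∃ U : (ℕ → ℕ) → Set Y,
    (∀ α, U α ∈ 𝓝 y) ∧ (∀ V ∈ 𝓝 y, ∃ α, U α ⊆ V) ∧ (∀ α β, α ≤ β → U β ⊆ U α)

open Set Filter

namespace CL

variable {X : Type u} [TopologicalSpace X]

/-! If `X` is locally compact and second countable, countably many compact sets replace all `K` in
the subbase, so `CL X` is even second countable. Conversely, work near a singleton `{a}`: adding
points outside a suitable compact set stays in a given neighborhood. The Fréchet–Urysohn property
then forces local compactness, and an `ω^ω`-base makes separated subsets of `X` countable, via
`countable_of_monotone_finite_cover`. -/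

theorem isOpen_hit {U : Set X} (hU : IsOpen U) : IsOpen (hit U : Set (CL X)) := by
  rcases U.eq_empty_or_nonempty with rfl | hne
  · simp [hit]
  · exact TopologicalSpace.isOpen_generateFrom_of_mem (Or.inl ⟨U, hU, hne, rfl⟩)

theorem isOpen_inside_compl {K : Set X} (hK : IsCompact K) :
    IsOpen (inside Kᶜ : Set (CL X)) := by
  by_cases h : K = univ
  · have : (inside Kᶜ : Set (CL X)) = ∅ := by
      ext A
      simpa [inside, h, subset_empty_iff] using A.2.1.ne_empty
    simp [this]
  · exact TopologicalSpace.isOpen_generateFrom_of_mem (Or.inr ⟨K, hK, h, rfl⟩)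

/-- A Fell neighborhood of `A` contains all closed supersets of `A` that miss some compact set
disjoint from `A`. -/
theorem exists_compact_of_mem_nhds {A : CL X} {W : Set (CL X)} (hW : W ∈ 𝓝 A) :
    ∃ K : Set X, IsCompact K ∧ Disjoint A.1 K ∧
      ∀ B : CL X, A.1 ⊆ B.1 → Disjoint B.1 K → B ∈ W := by
  obtain ⟨V, hVW, hV, hAV⟩ := mem_nhds_iff.1 hW
  suffices h : ∃ K : Set X, IsCompact K ∧ Disjoint A.1 K ∧
      ∀ B : CL X, A.1 ⊆ B.1 → Disjoint B.1 K → B ∈ V by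
    obtain ⟨K, h1, h2, h3⟩ := h
    exact ⟨K, h1, h2, fun B hB hBK => hVW (h3 B hB hBK)⟩
  clear hVW hW
  induction hV with
  | basic S hS =>
    rcases hS with ⟨U, -, -, rfl⟩ | ⟨K, hK, -, rfl⟩
    · exact ⟨∅, isCompact_empty, disjoint_empty _,
        fun B hB _ => hAV.mono (inter_subset_inter_left _ hB)⟩
    · exact ⟨K, hK, subset_compl_iff_disjoint_right.1 hAV,
        fun B _ hB => subset_compl_iff_disjoint_right.2 hB⟩
  | univ => exact ⟨∅, isCompact_empty, disjoint_empty _, fun _ _ _ => trivial⟩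
  | inter S T _ _ hS hT =>
    obtain ⟨K, h1, h2, h3⟩ := hS hAV.1
    obtain ⟨L, k1, k2, k3⟩ := hT hAV.2
    refine ⟨K ∪ L, h1.union k1, disjoint_union_right.2 ⟨h2, k2⟩, fun B hB hBK => ?_⟩
    rw [disjoint_union_right] at hBK
    exact ⟨h3 B hB hBK.1, k3 B hB hBK.2⟩
  | sUnion 𝒮 _ h =>
    obtain ⟨S, hS, hAS⟩ := hAV
    obtain ⟨K, h1, h2, h3⟩ := h S hS hAS
    exact ⟨K, h1, h2, fun B hB hBK => ⟨S, hS, h3 B hB hBK⟩⟩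

/-- Adjoin a finite set of points to a closed set. -/
def adjoin [T1Space X] (A : CL X) (F : Set X) (hF : F.Finite) : CL X :=
  ⟨A.1 ∪ F, A.2.1.inl, A.2.2.union hF.isClosed⟩

/-- In a locally compact second countable Hausdorff space, countably many compact sets suffice to
separate compact sets from disjoint closed sets. -/
theorem exists_countable_compact_separating [T2Space X] [LocallyCompactSpace X]
    [SecondCountableTopology X] :
    ∃ 𝒦 : Set (Set X), 𝒦.Countable ∧ (∀ L ∈ 𝒦, IsCompact L) ∧
      ∀ A K : Set X, IsClosed A → IsCompact K → Disjoint A K →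
        ∃ L ∈ 𝒦, K ⊆ L ∧ Disjoint A L := by
  refine ⟨{L | IsCompact L ∧ ∃ F ⊆ TopologicalSpace.countableBasis X, F.Finite ∧
    L = ⋃ V ∈ F, closure V}, ?_, fun L hL => hL.1, ?_⟩
  · refine ((countable_ofPred_finite_subset
      (TopologicalSpace.countable_countableBasis X)).image (fun F => ⋃ V ∈ F, closure V)).mono ?_
    rintro L ⟨-, F, hF, hfin, rfl⟩
    exact ⟨F, ⟨hfin, hF⟩, rfl⟩
  intro A K hA hK hAK
  -- Compact induction: being separated from `A` passes to subsets and finite unions, and holds near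
  -- each point by local compactness.
  refine hK.induction_on (p := fun K => ∃ L ∈ _, K ⊆ L ∧ Disjoint A L) ?_ ?_ ?_ ?_
  · exact ⟨∅, ⟨isCompact_empty, ∅, empty_subset _, finite_empty, by simp⟩, empty_subset _,
      disjoint_empty _⟩
  · rintro s t hst ⟨L, hL, h1, h2⟩
    exact ⟨L, hL, hst.trans h1, h2⟩
  · rintro s t ⟨L, ⟨hL, F, hF, hFf, rfl⟩, h1, h2⟩ ⟨M, ⟨hM, G, hG, hGf, rfl⟩, k1, k2⟩
    refine ⟨_, ⟨hL.union hM, F ∪ G, union_subset hF hG, hFf.union hGf, ?_⟩,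
      union_subset_union h1 k1, disjoint_union_right.2 ⟨h2, k2⟩⟩
    rw [biUnion_union]
  · intro x hx
    obtain ⟨C, hCx, hCA, hC⟩ := local_compact_nhds
      (hA.isOpen_compl.mem_nhds (disjoint_right.1 hAK hx))
    obtain ⟨V, hV, hxV, hVC⟩ :=
      (TopologicalSpace.isBasis_countableBasis X).mem_nhds_iff.1 hCx
    have hcl : closure V ⊆ C := closure_minimal hVC hC.isClosed
    refine ⟨V, mem_nhdsWithin_of_mem_nhds
      ((TopologicalSpace.isBasis_countableBasis X).mem_nhds hV hxV), closure V,
      ⟨hC.of_isClosed_subset isClosed_closure hcl, {V}, singleton_subset_iff.2 hV,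
        finite_singleton _, by simp⟩, subset_closure,
      subset_compl_iff_disjoint_left.1 (hcl.trans hCA)⟩

theorem secondCountableTopology [T2Space X] [LocallyCompactSpace X] [SecondCountableTopology X] :
    SecondCountableTopology (CL X) := by
  obtain ⟨𝒦, h𝒦, hcomp, hsep⟩ := exists_countable_compact_separating (X := X)
  refine ⟨hit '' TopologicalSpace.countableBasis X ∪ (fun L => inside Lᶜ) '' 𝒦,
    ((TopologicalSpace.countable_countableBasis X).image _).union (h𝒦.image _),
    le_antisymm (le_generateFrom ?_) (le_generateFrom ?_)⟩
  · rintro _ (⟨U, hU, rfl⟩ | ⟨L, hL, rfl⟩)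
    · exact isOpen_hit (TopologicalSpace.isOpen_of_mem_countableBasis hU)
    · exact isOpen_inside_compl (hcomp L hL)
  · rintro _ (⟨U, hU, -, rfl⟩ | ⟨K, hK, -, rfl⟩)
    · refine (@isOpen_iff_forall_mem_open _ (_) _).2 ?_
      rintro A ⟨x, hxA, hxU⟩
      obtain ⟨V, hV, hxV, hVU⟩ :=
        (TopologicalSpace.isBasis_countableBasis X).exists_subset_of_mem_open hxU hU
      exact ⟨hit V, fun B hB => hB.mono (inter_subset_inter_right _ hVU),
        TopologicalSpace.isOpen_generateFrom_of_mem (Or.inl ⟨V, hV, rfl⟩), ⟨x, hxA, hxV⟩⟩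
    · refine (@isOpen_iff_forall_mem_open _ (_) _).2 ?_
      intro A hA
      obtain ⟨L, hL, hKL, hAL⟩ := hsep A.1 K A.2.2 hK (subset_compl_iff_disjoint_right.1 hA)
      exact ⟨inside Lᶜ, fun B hB => hB.trans (compl_subset_compl.2 hKL),
        TopologicalSpace.isOpen_generateFrom_of_mem (Or.inr ⟨L, hL, rfl⟩),
        subset_compl_iff_disjoint_right.2 hAL⟩

end CL

theorem hasOmegaOmegaBase_of_firstCountable (Y : Type u) [TopologicalSpace Y]
    [FirstCountableTopology Y] : HasOmegaOmegaBase Y := by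
  intro y
  obtain ⟨V, hV⟩ := (𝓝 y).exists_antitone_basis
  refine ⟨fun α => V (α 0), fun α => hV.mem _, fun W hW => ?_, fun α β h => hV.antitone (h 0)⟩
  obtain ⟨n, hn⟩ := hV.mem_iff.1 hW
  exact ⟨fun _ => n, hn⟩

/-- A set covered by a monotone family of finite sets indexed by `ω^ω` is countable. -/
theorem countable_of_monotone_finite_cover {D : Type*} (S : Set D) (F : (ℕ → ℕ) → Set D)
    (hmono : Monotone F) (hfin : ∀ α, (F α).Finite) (hcov : ∀ x ∈ S, ∃ α, x ∈ F α) :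
    S.Countable := by
  classical
  -- `E s` is the union of the `F β` over all `β` extending `s`. Finitely many points of it lie in
  -- one `F γ`, with `γ` the pointwise supremum of their `β`.
  let E : List ℕ → Set D := fun s => {x | ∃ β : ℕ → ℕ, x ∈ F β ∧ (∀ i, ∀ h : i < s.length, β i = s[i])}
  have key : ∀ α : ℕ → ℕ, ∃ n, (E ((List.range n).map α)).Finite := by
    intro α
    by_contra! hinf
    have hT : ∀ n, ∃ γ : ℕ → ℕ, (∀ i < n, γ i ≤ α i) ∧
        ∃ T : Finset D, T.card = n ∧ (T : Set D) ⊆ F γ := by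
      intro n
      obtain ⟨T, hTE, hTn⟩ := Set.Infinite.exists_subset_card_eq (hinf n) n
      choose! β hβ hβα using fun x (hx : x ∈ T) => hTE hx
      refine ⟨fun i => T.sup fun x => β x i, fun i hi => Finset.sup_le fun x hx => ?_, T, hTn,
        fun x hx => hmono (fun i => ?_) (hβ x hx)⟩
      · rw [hβα x hx i (by simpa using hi)]
        simp
      · exact Finset.le_sup (f := fun x => β x i) hx
    choose γ hγα T hTn hTF using hT
    -- At coordinate `i` every `γ n` with `n > i` is at most `α i`, so only `n ≤ i` must be summed.
    -- Then `F δ` contains `n` points for every `n`.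
    let δ : ℕ → ℕ := fun i => α i + ∑ n ∈ Finset.range (i + 1), γ n i
    have hle : ∀ n, γ n ≤ δ := by
      intro n i
      rcases lt_or_ge i n with h | h
      · exact (hγα n i h).trans (Nat.le_add_right _ _)
      · exact (Finset.single_le_sum (f := fun n => γ n i) (fun _ _ => Nat.zero_le _)
          (Finset.mem_range.2 (Nat.lt_succ_of_le h))).trans (Nat.le_add_left _ _)
    have hsub : T ((hfin δ).toFinset.card + 1) ⊆ (hfin δ).toFinset := fun x hx =>
      (hfin δ).mem_toFinset.2 (hmono (hle _) (hTF _ hx))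
    have := Finset.card_le_card hsub
    rw [hTn] at this
    omega
  have hc : (⋃ s ∈ {s | (E s).Finite}, E s).Countable :=
    (to_countable _).biUnion fun s hs => Set.Finite.countable hs
  refine hc.mono fun x hx => ?_
  obtain ⟨α, hα⟩ := hcov x hx
  obtain ⟨n, hn⟩ := key α
  exact mem_biUnion (x := (List.range n).map α) hn ⟨α, hα, by simp⟩

namespace CL

open Metric

variable {X : Type u}

theorem weaklyLocallyCompactSpace_of_frechetUrysohn [MetricSpace X] [Nontrivial X]
    [FrechetUrysohnSpace (CL X)] : WeaklyLocallyCompactSpace X := by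
  refine ⟨fun x => ?_⟩
  by_contra! hx
  have hball : ∀ r > 0, ¬ IsCompact (closedBall x r) := fun r hr h =>
    hx _ h (closedBall_mem_nhds x hr)
  obtain ⟨a, ha⟩ := exists_ne x
  have hr : 0 < dist a x := dist_pos.2 ha
  set r := dist a x / 2 with hrdef
  have hr' : 0 < r := half_pos hr
  have hax : a ∉ closedBall x r := by simp only [mem_closedBall]; linarith
  let A : CL X := ⟨{a}, singleton_nonempty a, isClosed_singleton⟩
  obtain ⟨z, hzmem, hz⟩ : ∃ z : ℕ → X, (∀ n, z n ∈ closedBall x r) ∧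
      ∀ p ∈ closedBall x r, ∀ φ : ℕ → ℕ, StrictMono φ → ¬ Tendsto (z ∘ φ) atTop (𝓝 p) := by
    have h := hball r hr'
    rw [isCompact_iff_isSeqCompact, IsSeqCompact] at h
    push Not at h
    exact h
  have hzK : ∀ K : Set X, IsCompact K → ∀ᶠ n in atTop, z n ∉ K := by
    intro K hK
    by_contra h
    obtain ⟨φ, hφ, hφK⟩ := extraction_of_frequently_atTop (not_eventually.1 h)
    obtain ⟨p, -, ψ, hψ, hp⟩ := hK.tendsto_subseq (fun n => not_not.1 (hφK n))
    exact hz p (isClosed_closedBall.mem_of_tendsto hp (Eventually.of_forall fun n => hzmem _))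
      (φ ∘ ψ) (hφ.comp hψ) hp
  -- The point `z n` records the index: convergence to `{a}` forces `n → ∞`, hence `y → x`. But then
  -- `x` and the `y`'s form a compact set missing `a`, which the sets must eventually avoid.
  let 𝒜 : Set (CL X) := {B | ∃ n : ℕ, ∃ y ∈ closedBall x (r / (n + 1)),
    B = A.adjoin {y, z n} (toFinite _)}
  have hcl : A ∈ closure 𝒜 := by
    rw [mem_closure_iff_nhds]
    intro W hW
    obtain ⟨K, hK, hAK, hKW⟩ := exists_compact_of_mem_nhds hW
    obtain ⟨n, hn⟩ := (hzK K hK).exists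
    obtain ⟨y, hy, hyK⟩ : ∃ y ∈ closedBall x (r / (n + 1)), y ∉ K := by
      by_contra! h
      exact hball _ (by positivity) (hK.of_isClosed_subset isClosed_closedBall h)
    refine ⟨A.adjoin {y, z n} (toFinite _), hKW _ subset_union_left ?_, n, y, hy, rfl⟩
    simp [adjoin, hAK, hyK, hn]
  obtain ⟨B, hB, hBA⟩ := mem_closure_iff_seq_limit.1 hcl
  choose n y hy hBeq using hB
  have hmiss : ∀ K : Set X, IsCompact K → a ∉ K → ∀ᶠ k in atTop, y k ∉ K ∧ z (n k) ∉ K := by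
    intro K hK haK
    filter_upwards [hBA ((isOpen_inside_compl hK).mem_nhds
      (show A.1 ⊆ Kᶜ from singleton_subset_iff.2 haK))] with k hk
    rw [mem_preimage, hBeq] at hk
    exact ⟨hk (Or.inr (by simp)), hk (Or.inr (by simp))⟩
  have hn : Tendsto n atTop atTop := by
    refine tendsto_atTop.2 fun m => ?_
    have hfin : (z '' Iio m).Finite := (finite_Iio m).image z
    filter_upwards [hmiss _ hfin.isCompact (by
      rintro ⟨i, -, hi⟩
      exact hax (hi ▸ hzmem i))] with k hk
    by_contra! h
    exact hk.2 ⟨_, h, rfl⟩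
  have hyx : Tendsto y atTop (𝓝 x) := by
    rw [tendsto_iff_dist_tendsto_zero]
    refine squeeze_zero (fun _ => dist_nonneg) (fun k => hy k) ?_
    exact (tendsto_const_div_atTop_nhds_zero_nat r |>.comp (tendsto_add_atTop_nat 1)).comp hn |>.congr
      fun k => by simp
  obtain ⟨k, hk⟩ := (hmiss _ hyx.isCompact_insert_range (by
    rintro (rfl | ⟨i, rfl⟩)
    · exact ha rfl
    · exact hax (closedBall_subset_closedBall (div_le_self hr'.le (by simp)) (hy i)))).exists
  exact hk.1 (Or.inr ⟨k, rfl⟩)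

/-- Finitely many closed `ε / 2`-balls cover `K`, and each holds at most one point of `D`. -/
theorem _root_.Metric.IsSeparated.finite_inter_isCompact [PseudoMetricSpace X] {ε : NNReal}
    (hε : ε ≠ 0) {D K : Set X} (hD : IsSeparated ε D) (hK : IsCompact K) : (D ∩ K).Finite := by
  obtain ⟨N, -, hN, hcov⟩ := exists_finite_isCover_of_isCompact (half_pos hε.bot_lt).ne' hK
  rw [isCover_iff_subset_iUnion_closedEBall] at hcov
  refine (hN.biUnion (t := fun y => D ∩ closedEBall y (ε / 2 : NNReal)) fun y _ =>
    Subsingleton.finite ?_).subset fun x hx => ?_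
  · rintro u ⟨huD, hu⟩ v ⟨hvD, hv⟩
    by_contra h
    refine (hD huD hvD h).not_ge ((edist_triangle_right u v y).trans ((add_le_add hu hv).trans ?_))
    rw [← ENNReal.coe_add, add_halves]
  · obtain ⟨y, hy, hxy⟩ := mem_iUnion₂.1 (hcov hx.2)
    exact mem_iUnion₂.2 ⟨y, hy, hx.1, hxy⟩

theorem countable_of_isSeparated [MetricSpace X] (hX : HasOmegaOmegaBase (CL X)) {ε : NNReal}
    (hε : ε ≠ 0) {D : Set X} (hD : IsSeparated ε D) : D.Countable := by
  rcases D.eq_empty_or_nonempty with rfl | ⟨a, -⟩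
  · exact countable_empty
  let A : CL X := ⟨{a}, singleton_nonempty a, isClosed_singleton⟩
  obtain ⟨U, hU, hbase, hmono⟩ := hX A
  suffices h : (D \ {a}).Countable from
    (h.union (countable_singleton a)).mono fun x hx => by by_cases h : x = a <;> simp [h, hx]
  refine countable_of_monotone_finite_cover _
    -- Only points of the compact set attached to `U α` can be excluded, so these sets are finite.
    (fun α => {x ∈ D \ {a} | A.adjoin {x} (finite_singleton x) ∉ U α}) ?_ ?_ ?_
  · exact fun α β h x hx => ⟨hx.1, fun hβ => hx.2 (hmono α β h hβ)⟩
  · intro α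
    obtain ⟨K, hK, hAK, hKU⟩ := exists_compact_of_mem_nhds (hU α)
    have hsub : {x ∈ D \ {a} | A.adjoin {x} (finite_singleton x) ∉ U α} ⊆ D ∩ K := by
      intro x hx
      refine ⟨hx.1.1, by_contra fun hxK => hx.2 (hKU _ subset_union_left ?_)⟩
      simp [adjoin, hAK, hxK]
    exact (hD.finite_inter_isCompact hε hK).subset hsub
  · intro x hx
    obtain ⟨α, hα⟩ := hbase (inside {x}ᶜ) ((isOpen_inside_compl isCompact_singleton).mem_nhds
      (show A.1 ⊆ {x}ᶜ from singleton_subset_iff.2 (Ne.symm hx.2)))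
    exact ⟨α, hx, fun h => hα h (Or.inr rfl) rfl⟩

theorem secondCountableTopology_of_hasOmegaOmegaBase [MetricSpace X]
    (hX : HasOmegaOmegaBase (CL X)) : SecondCountableTopology X := by
  refine Metric.secondCountable_of_almost_dense_set fun ε hε => ?_
  lift ε to NNReal using hε.le
  -- A maximal `ε`-separated set is an `ε`-net.
  obtain ⟨D, hD⟩ := zorn_subset {D : Set X | D ⊆ univ ∧ IsSeparated ε D} fun c hc hchain =>
    ⟨⋃₀ c, ⟨subset_univ _, (pairwise_sUnion hchain.directedOn).2 fun s hs => (hc hs).2⟩,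
      fun s hs => subset_sUnion_of_mem hs⟩
  refine ⟨D, countable_of_isSeparated hX (by exact_mod_cast hε.ne') hD.prop.2, fun x => ?_⟩
  obtain ⟨y, hy, hxy⟩ := IsCover.of_maximal_isSeparated hD (mem_univ x)
  exact ⟨y, hy, by
    rw [← coe_nndist]
    exact_mod_cast (edist_nndist x y).symm.trans_le hxy⟩

end CL

theorem theorem3p16 (X : Type u) [TopologicalSpace X] [TopologicalSpace.MetrizableSpace X] :
    [FrechetUrysohnSpace (CL X) ∧ HasOmegaOmegaBase (CL X),
      FirstCountableTopology (CL X),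
      LocallyCompactSpace X ∧ SecondCountableTopology X].TFAE := by
  tfae_have 2 → 1 := fun _ => ⟨inferInstance, hasOmegaOmegaBase_of_firstCountable _⟩
  tfae_have 3 → 2 := by
    rintro ⟨_, _⟩
    have := CL.secondCountableTopology (X := X)
    infer_instance
  tfae_have 1 → 3 := by
    rintro ⟨_, hX⟩
    let _ := TopologicalSpace.metrizableSpaceMetric X
    refine ⟨?_, CL.secondCountableTopology_of_hasOmegaOmegaBase hX⟩
    rcases subsingleton_or_nontrivial X with _ | _
    · infer_instance
    · have := CL.weaklyLocallyCompactSpace_of_frechetUrysohn (X := X)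
      infer_instance
  tfae_finish
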